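/- For positive integers $a_1,a_2,a_3$ with $\gcd(a_1,a_2,a_3)=1$, let $g_3(a_1,a_2,a_3)$ be the Frobenius number, that is, the largest integer that is not a non-negative integer combination of $a_1,a_2,a_3$ (so $g_3=-1$ if some $a_i=1$), and let $f_3(a_1,a_2,a_3)=g_3(a_1,a_2,a_3)+a_1+a_2+a_3$; equivalently, $f_3(a_1,a_2,a_3)$ is the largest integer that is not a combination of $a_1,a_2,a_3$ with positive integer coefficients. Then for all positive integers $a_1,a_2,a_3$ with $\gcd(a_1,a_2,a_3)=1$, $$f_3(a_1,a_2,a_3)\ \ge\ (3a_1a_2a_3)^{1/2}.$$ Moreover, for every $\varepsilon>0$ and every point $\alpha=(\alpha_1,\alpha_2)\in\mathbb R^2$ with $0\le\alpha_1\le\alpha_2\le 1$ there exist integers $0<a_1<a_2<a_3$ with $\gcd(a_1,a_2,a_3)=1$ such that $$\left|\alpha_i-\frac{a_i}{a_3}\right|<\varepsilon,\qquad i=1,2,$$ and $$f_3(a_1,a_2,a_3)<\bigl((3+\varepsilon)a_1a_2a_3\bigr)^{1/2}.$$ -/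

import Mathlib

/-- `n` is a non-negative integer combination of the `a i`. -/
def IsNonnegCombination {N : ℕ} (a : Fin N → ℕ) (n : ℤ) : Prop :=
  ∃ x : Fin N → ℕ, n = ∑ i, (x i : ℤ) * (a i : ℤ)

/-- `n` is a positive integer combination of the `a i`. -/
def IsPosCombination {N : ℕ} (a : Fin N → ℕ) (n : ℤ) : Prop :=
  ∃ x : Fin N → ℕ, (∀ i, 0 < x i) ∧ n = ∑ i, (x i : ℤ) * (a i : ℤ)

/-- The Frobenius number `g_N(a_1, …, a_N)`: the largest integer that is not a non-negative integer
combination of the `a i`. It is `-1` if some `a i` is `1`. -/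
noncomputable def frobeniusG {N : ℕ} (a : Fin N → ℕ) : ℤ :=
  sSup {n : ℤ | ¬ IsNonnegCombination a n}

/-- `f_N(a_1, …, a_N) = g_N(a_1, …, a_N) + a_1 + ⋯ + a_N`. -/
noncomputable def frobeniusF {N : ℕ} (a : Fin N → ℕ) : ℤ :=
  frobeniusG a + ∑ i, (a i : ℤ)

/-- For coprime `a i`, the supremum defining `frobeniusG` is a maximum. -/
theorem isGreatest_frobeniusG {N : ℕ} (a : Fin N → ℕ) (hgcd : Finset.univ.gcd a = 1) :
    IsGreatest {n : ℤ | ¬ IsNonnegCombination a n} (frobeniusG a) := by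
  have hne : {n : ℤ | ¬ IsNonnegCombination a n}.Nonempty := by
    refine ⟨-1, ?_⟩
    rintro ⟨x, hx⟩
    have : (0 : ℤ) ≤ ∑ i, (x i : ℤ) * (a i : ℤ) := Finset.sum_nonneg fun i _ => by positivity
    omega
  have hset : Nat.setGcd (Set.range a) = 1 := by
    rw [← Nat.dvd_one, ← hgcd]
    exact Finset.dvd_gcd fun i _ => Nat.setGcd_dvd_of_mem (Set.mem_range_self i)
  have hbdd : BddAbove {n : ℤ | ¬ IsNonnegCombination a n} := by
    obtain ⟨m, hm⟩ := Nat.exists_mem_closure_of_ge (Set.range a)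
    refine ⟨m, fun n hn => ?_⟩
    by_contra hlt
    push Not at hlt
    apply hn
    lift n to ℕ using by omega
    have h := hm n (by omega) (by rw [hset]; exact one_dvd n)
    rw [← Submodule.span_nat_eq_addSubmonoidClosure, Submodule.mem_toAddSubmonoid,
      Submodule.mem_span_range_iff_exists_fun] at h
    obtain ⟨x, hx⟩ := h
    refine ⟨x, ?_⟩
    rw [← hx]
    simp
  exact ⟨Int.csSup_mem hne hbdd, fun n hn => le_csSup hbdd hn⟩

theorem isPosCombination_iff {N : ℕ} (a : Fin N → ℕ) (n : ℤ) :
    IsPosCombination a n ↔ IsNonnegCombination a (n - ∑ i, (a i : ℤ)) := by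
  constructor
  · rintro ⟨x, hx, rfl⟩
    refine ⟨fun i => x i - 1, ?_⟩
    rw [← Finset.sum_sub_distrib]
    refine Finset.sum_congr rfl fun i _ => ?_
    rw [Nat.cast_sub (hx i)]
    push_cast
    ring
  · rintro ⟨x, hx⟩
    refine ⟨fun i => x i + 1, fun i => Nat.succ_pos _, ?_⟩
    rw [sub_eq_iff_eq_add] at hx
    rw [hx, ← Finset.sum_add_distrib]
    refine Finset.sum_congr rfl fun i _ => ?_
    push_cast
    ring

/-- For coprime `a i`, `frobeniusF a` is the largest integer that is not a positive integer
combination of the `a i`. -/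
theorem isGreatest_frobeniusF {N : ℕ} (a : Fin N → ℕ) (hgcd : Finset.univ.gcd a = 1) :
    IsGreatest {n : ℤ | ¬ IsPosCombination a n} (frobeniusF a) := by
  obtain ⟨h1, h2⟩ := isGreatest_frobeniusG a hgcd
  constructor
  · change ¬ IsPosCombination a _
    rw [isPosCombination_iff]
    simpa [frobeniusF] using h1
  · intro n hn
    change ¬ IsPosCombination a _ at hn
    rw [isPosCombination_iff] at hn
    have := h2 hn
    rw [frobeniusF]
    omega

/-!
Write `a, b, c` for the generators and call the least point of a residue class modulo `c` the point
`(x, y)` of `ℕ²` in that class (of `a x + b y`) whose weight `a x + b y` is least. For such a point,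
`a (x + 1) + b (y + 1)` is not a positive combination, so it is at most `frobeniusF`.

*Lower bound.* The least points form a staircase with `c` elements, and an inner corner of the
staircase off the axes must lie in the zero class. Two such corners would identify a point of one
axis with a point of the other, so there is at most one of them, and the staircase is an L-shape
(`exists_lShape`). Let `(p, q + j)` and `(p + i, q)` be its outer corners, and let
`A = a (p + 1)`, `B = b (q + 1)`, `I = a i`, `J = b j`. Counting points gives
`a b c ≤ A B + A J + I B`, whereas `frobeniusF` is at least `A + B + max I J`. The bound now follows
from `3 (A B + A K + B K) ≤ (A + B + K) ^ 2` (`sqrt_le_frobeniusF`).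

*Sharpness.* Equality needs `A = B = I = J`, that is, the lattice `a x + b y + c z = 0` should nearly
be spanned by multiples of `(2 / a, -1 / b, -1 / c)` and `(-1 / a, 2 / b, -1 / c)`. Conversely, two
such vectors determine the generators as their minors (`extremalTriple`); small perturbations make
the minors coprime, and reduction modulo the two vectors bounds `frobeniusF` from above
(`frobeniusF_le_max`). The ratios `R / P`, `R / Q` of the generators in the limit are arbitrary
rationals with `0 < R / P < R / Q < 1`, and these pairs are dense.
-/

/-! ### The staircase of least points -/

/-- Order on the points of `ℕ²` by the weight `a x + b y`, ties being broken by the first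
coordinate. For `0 < b` it is a total order, invariant under translations. -/
def WeightLE (a b x y x' y' : ℕ) : Prop :=
  a * x + b * y < a * x' + b * y' ∨ (a * x + b * y = a * x' + b * y' ∧ x ≤ x')

theorem weightLE_add_iff (a b x y x' y' i j : ℕ) :
    WeightLE a b (x + i) (y + j) (x' + i) (y' + j) ↔ WeightLE a b x y x' y' := by
  simp only [WeightLE, mul_add]
  omega

theorem WeightLE.antisymm {a b x y x' y' : ℕ} (hb : 0 < b) (h : WeightLE a b x y x' y')
    (h' : WeightLE a b x' y' x y) : x = x' ∧ y = y' := by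
  simp only [WeightLE] at h h'
  obtain rfl : x = x' := by omega
  exact ⟨rfl, Nat.eq_of_mul_eq_mul_left hb (by omega)⟩

/-- `(x, y)` is the least point, for `WeightLE a b`, among the points `(x', y')` of `ℕ²` with
`a x' + b y' ≡ a x + b y` modulo `c`. These points form a staircase with one point for each
residue class. -/
def IsLeastInClass (a b c x y : ℕ) : Prop :=
  ∀ x' y', a * x + b * y ≡ a * x' + b * y' [MOD c] → WeightLE a b x y x' y'

theorem IsLeastInClass.eq {a b c x y x' y' : ℕ} (hb : 0 < b) (h : IsLeastInClass a b c x y)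
    (h' : IsLeastInClass a b c x' y') (hmod : a * x + b * y ≡ a * x' + b * y' [MOD c]) :
    x = x' ∧ y = y' :=
  (h _ _ hmod).antisymm hb (h' _ _ hmod.symm)

theorem modEq_translate {a b c x y x' y' : ℕ} (i j : ℕ)
    (h : a * x + b * y ≡ a * x' + b * y' [MOD c]) :
    a * (x + i) + b * (y + j) ≡ a * (x' + i) + b * (y' + j) [MOD c] := by
  have := h.add_right (a * i + b * j)
  convert this using 1 <;> ring

theorem modEq_of_translate {a b c x y x' y' : ℕ} (i j : ℕ)
    (h : a * (x + i) + b * (y + j) ≡ a * (x' + i) + b * (y' + j) [MOD c]) :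
    a * x + b * y ≡ a * x' + b * y' [MOD c] := by
  apply Nat.ModEq.add_right_cancel' (a * i + b * j)
  convert h using 1 <;> ring

theorem IsLeastInClass.of_le {a b c x y x' y' : ℕ} (h : IsLeastInClass a b c x y)
    (hx : x' ≤ x) (hy : y' ≤ y) : IsLeastInClass a b c x' y' := by
  obtain ⟨i, rfl⟩ := Nat.exists_eq_add_of_le hx
  obtain ⟨j, rfl⟩ := Nat.exists_eq_add_of_le hy
  intro u v huv
  exact (weightLE_add_iff a b x' y' u v i j).1 (h _ _ (modEq_translate i j huv))

theorem exists_isLeastInClass (a b c x y : ℕ) :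
    ∃ x' y', IsLeastInClass a b c x' y' ∧ a * x + b * y ≡ a * x' + b * y' [MOD c] := by
  let key : ℕ × ℕ → ℕ ×ₗ ℕ := fun p => toLex (a * p.1 + b * p.2, p.1)
  obtain ⟨p, hp, hmin⟩ := (InvImage.wf key wellFounded_lt).has_min
    {p : ℕ × ℕ | a * x + b * y ≡ a * p.1 + b * p.2 [MOD c]} ⟨(x, y), Nat.ModEq.refl _⟩
  refine ⟨p.1, p.2, fun u v huv => ?_, hp⟩
  have h := not_lt.1 (hmin (u, v) (hp.trans huv))
  exact Prod.Lex.toLex_le_toLex.1 h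

theorem isLeastInClass_zero {a b : ℕ} (c : ℕ) : IsLeastInClass a b c 0 0 := by
  intro u v _
  simp only [WeightLE, mul_zero, add_zero, zero_le, and_true]
  omega

/-- `(p + 1, q + 1)` is an inner corner of the staircase of least points, away from the axes,
and its residue class is zero. -/
structure IsInnerCorner (a b c p q : ℕ) : Prop where
  modEq : a * (p + 1) + b * (q + 1) ≡ 0 [MOD c]
  left : IsLeastInClass a b c p (q + 1)
  below : IsLeastInClass a b c (p + 1) q

theorem IsInnerCorner.not_isLeastInClass {a b c p q : ℕ} (hb : 0 < b)
    (h : IsInnerCorner a b c p q) : ¬ IsLeastInClass a b c (p + 1) (q + 1) := fun h' => by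
  have := (h'.eq hb (isLeastInClass_zero c) (by simpa using h.modEq)).1
  omega

/-- The least point of the class of an inner corner lies on both axes: if it could be translated
by a unit vector towards an axis, so could the corner, and the two translates would be least
points of the same class. -/
theorem exists_isInnerCorner {a b c : ℕ} (hb : 0 < b) :
    ∀ x y, ¬ IsLeastInClass a b c x y → IsLeastInClass a b c x 0 → IsLeastInClass a b c 0 y →
      ∃ p q, p < x ∧ q < y ∧ IsInnerCorner a b c p q := by
  intro x
  induction x with
  | zero => exact fun y h _ h' => absurd h' h
  | succ p ihp =>
    intro y
    induction y with
    | zero => exact fun h h' _ => absurd h' h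
    | succ q ihq =>
      intro h hx hy
      by_cases hl : IsLeastInClass a b c p (q + 1)
      swap
      · obtain ⟨u, v, hu, hv, huv⟩ := ihp _ hl (hx.of_le (by omega) le_rfl) hy
        exact ⟨u, v, by omega, hv, huv⟩
      by_cases hd : IsLeastInClass a b c (p + 1) q
      swap
      · obtain ⟨u, v, hu, hv, huv⟩ := ihq hd hx (hy.of_le le_rfl (by omega))
        exact ⟨u, v, hu, by omega, huv⟩
      refine ⟨p, q, by omega, by omega, ?_, hl, hd⟩
      obtain ⟨x', y', hleast, hmod⟩ := exists_isLeastInClass a b c (p + 1) (q + 1)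
      rcases x' with _ | x'
      · rcases y' with _ | y'
        · simpa using hmod
        · obtain ⟨h1, rfl⟩ := hd.eq hb (hleast.of_le le_rfl (Nat.le_succ _))
            (modEq_of_translate 0 1 hmod)
          omega
      · obtain ⟨rfl, rfl⟩ := hl.eq hb (hleast.of_le (Nat.le_succ _) le_rfl)
          (modEq_of_translate 1 0 hmod)
        exact absurd hleast h

theorem IsInnerCorner.fst_le {a b c p q p' q' : ℕ} (hb : 0 < b)
    (h : IsInnerCorner a b c p q) (h' : IsInnerCorner a b c p' q') : p' ≤ p := by
  by_contra! hp
  rcases le_or_gt q q' with hq | hq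
  · exact h.not_isLeastInClass hb (h'.left.of_le (by omega) (by omega))
  · -- Both corners lie in the zero class, so their difference identifies a point of each axis.
    have h1 : IsLeastInClass a b c (p' - p) 0 := h'.below.of_le (by omega) (by omega)
    have h2 : IsLeastInClass a b c 0 (q - q') := h.left.of_le (by omega) (by omega)
    have hmod : a * (p' - p) + b * 0 ≡ a * 0 + b * (q - q') [MOD c] := by
      apply modEq_of_translate (p + 1) (q' + 1)
      rw [show p' - p + (p + 1) = p' + 1 by omega, show q - q' + (q' + 1) = q + 1 by omega]
      simpa using h'.modEq.trans h.modEq.symm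
    have := (h1.eq hb h2 hmod).1
    omega

theorem IsInnerCorner.snd_le {a b c p q p' q' : ℕ} (hb : 0 < b)
    (h : IsInnerCorner a b c p q) (h' : IsInnerCorner a b c p' q') : q' ≤ q := by
  by_contra! hq
  obtain rfl : p = p' := le_antisymm (h'.fst_le hb h) (h.fst_le hb h')
  exact h.not_isLeastInClass hb (h'.below.of_le le_rfl (by omega))

/-- The point `(c, 0)` lies in the class of the origin, so the staircase is bounded. -/
theorem exists_axis_bound {a b c : ℕ} (ha : 0 < a) (hc : 0 < c) :
    ∃ l, IsLeastInClass a b c l 0 ∧ ¬ IsLeastInClass a b c (l + 1) 0 := by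
  by_contra! H
  have hall : ∀ l, IsLeastInClass a b c l 0 := fun l => by
    induction l with
    | zero => exact isLeastInClass_zero c
    | succ l ih => exact H l ih
  have h := hall c 0 0 (by simp [Nat.modEq_zero_iff_dvd])
  have := Nat.mul_pos ha hc
  simp only [WeightLE] at h
  omega

theorem exists_axis_bound_snd {a b c : ℕ} (hb : 0 < b) (hc : 0 < c) :
    ∃ h, IsLeastInClass a b c 0 h ∧ ¬ IsLeastInClass a b c 0 (h + 1) := by
  by_contra! H
  have hall : ∀ l, IsLeastInClass a b c 0 l := fun l => by
    induction l with
    | zero => exact isLeastInClass_zero c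
    | succ l ih => exact H l ih
  have h := hall c 0 0 (by simp [Nat.modEq_zero_iff_dvd])
  have := Nat.mul_pos hb hc
  simp only [WeightLE] at h
  omega

theorem le_card_of_isLeastInClass_mem {a b c : ℕ}
    (hrep : ∀ n : ℕ, ∃ x y, n ≡ a * x + b * y [MOD c]) (s : Finset (ℕ × ℕ))
    (hs : ∀ x y, IsLeastInClass a b c x y → (x, y) ∈ s) : c ≤ s.card := by
  classical
  have hsub : Finset.range c ⊆ s.image fun p => (a * p.1 + b * p.2) % c := by
    intro n hn
    rw [Finset.mem_range] at hn
    obtain ⟨x, y, hxy⟩ := hrep n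
    obtain ⟨x', y', hl, hmod⟩ := exists_isLeastInClass a b c x y
    refine Finset.mem_image.2 ⟨(x', y'), hs _ _ hl, ?_⟩
    have h := hxy.trans hmod
    rw [Nat.ModEq, Nat.mod_eq_of_lt hn] at h
    exact h.symm
  simpa using (Finset.card_le_card hsub).trans Finset.card_image_le

/-- The staircase of least points is a rectangle, or a rectangle from which a rectangle at the
outer corner has been removed. As it has at least `c` points, this bounds `c` in terms of the
outer corners of the staircase; the case of a rectangle is that of `i = j = 0`. -/
theorem exists_lShape {a b c : ℕ} (ha : 0 < a) (hb : 0 < b) (hc : 0 < c)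
    (hrep : ∀ n : ℕ, ∃ x y, n ≡ a * x + b * y [MOD c]) :
    ∃ p q i j, c ≤ (p + 1) * (q + 1) + (p + 1) * j + i * (q + 1) ∧
      IsLeastInClass a b c (p + i) q ∧ IsLeastInClass a b c p (q + j) := by
  obtain ⟨l, hl, hl'⟩ := exists_axis_bound (b := b) ha hc
  obtain ⟨h, hh, hh'⟩ := exists_axis_bound_snd (a := a) hb hc
  have hbox : ∀ x y, IsLeastInClass a b c x y → x ≤ l ∧ y ≤ h := fun x y hxy => by
    constructor
    · by_contra! hlt
      exact hl' (hxy.of_le hlt (Nat.zero_le _))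
    · by_contra! hlt
      exact hh' (hxy.of_le (Nat.zero_le _) hlt)
  by_cases hlh : IsLeastInClass a b c l h
  · refine ⟨l, h, 0, 0, ?_, hlh, hlh⟩
    refine (le_card_of_isLeastInClass_mem hrep (Finset.range (l + 1) ×ˢ Finset.range (h + 1))
      fun x y hxy => ?_).trans (by simp)
    have := hbox x y hxy
    simp only [Finset.mem_product, Finset.mem_range]
    omega
  · obtain ⟨p, q, hp, hq, hpq⟩ := exists_isInnerCorner hb l h hlh hl hh
    obtain ⟨i, rfl⟩ := Nat.exists_eq_add_of_lt hp
    obtain ⟨j, rfl⟩ := Nat.exists_eq_add_of_lt hq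
    refine ⟨p, q, i + 1, j + 1, ?_, ?_, ?_⟩
    · refine (le_card_of_isLeastInClass_mem hrep
        (Finset.range (p + 1) ×ˢ Finset.range (q + j + 2) ∪
          Finset.Ico (p + 1) (p + i + 2) ×ˢ Finset.range (q + 1)) fun x y hxy => ?_).trans ?_
      · have := hbox x y hxy
        have : ¬ (p + 1 ≤ x ∧ q + 1 ≤ y) := fun hlt =>
          hpq.not_isLeastInClass hb (hxy.of_le hlt.1 hlt.2)
        simp only [Finset.mem_union, Finset.mem_product, Finset.mem_range, Finset.mem_Ico]
        omega
      · refine (Finset.card_union_le _ _).trans (le_of_eq ?_)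
        simp only [Finset.card_product, Finset.card_range, Nat.card_Ico]
        rw [show p + i + 2 - (p + 1) = i + 1 by omega]
        ring
    · by_contra hnot
      obtain ⟨u, v, -, hv, huv⟩ := exists_isInnerCorner hb _ _ hnot hl
        (hh.of_le le_rfl (by omega))
      exact hv.not_ge (huv.snd_le hb hpq)
    · by_contra hnot
      obtain ⟨u, v, hu, -, huv⟩ := exists_isInnerCorner hb _ _ hnot
        (hl.of_le (by omega) le_rfl) hh
      exact hu.not_ge (huv.fst_le hb hpq)

/-! ### The lower bound -/

theorem exists_pos_repr {a : Fin 3 → ℕ} (ha : 0 < a 2) (hgcd : Finset.univ.gcd a = 1) (n : ℤ) :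
    ∃ (x y : ℕ) (z : ℤ), 0 < x ∧ 0 < y ∧ n = x * a 0 + y * a 1 + z * a 2 := by
  -- A translate of `n` by a large multiple of `a 2` exceeds `frobeniusF a`.
  have hcomb : IsPosCombination a (n + (|frobeniusF a - n| + 1) * a 2) := by
    by_contra hnot
    have h := (isGreatest_frobeniusF a hgcd).2 hnot
    have h2 : (1 : ℤ) ≤ a 2 := by exact_mod_cast ha
    nlinarith [le_abs_self (frobeniusF a - n), abs_nonneg (frobeniusF a - n)]
  obtain ⟨x, hx, hxn⟩ := hcomb
  rw [Fin.sum_univ_three] at hxn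
  exact ⟨x 0, x 1, x 2 - (|frobeniusF a - n| + 1), hx 0, hx 1, by linarith⟩

theorem le_frobeniusF_of_isLeastInClass {a : Fin 3 → ℕ} (hc : 0 < a 2)
    (hgcd : Finset.univ.gcd a = 1) {x y : ℕ} (h : IsLeastInClass (a 0) (a 1) (a 2) x y) :
    ((a 0 * (x + 1) + a 1 * (y + 1) : ℕ) : ℤ) ≤ frobeniusF a := by
  apply (isGreatest_frobeniusF a hgcd).2
  rintro ⟨u, hu, hsum⟩
  rw [Fin.sum_univ_three] at hsum
  obtain ⟨i, hi⟩ := Nat.exists_eq_add_of_lt (hu 0)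
  obtain ⟨j, hj⟩ := Nat.exists_eq_add_of_lt (hu 1)
  have hnat : a 0 * x + a 1 * y = a 0 * i + a 1 * j + a 2 * u 2 := by
    rw [hi, hj] at hsum
    push_cast at hsum
    zify
    linarith
  have hw := h i j (by rw [hnat]; simp [Nat.ModEq])
  have := Nat.mul_pos hc (hu 2)
  simp only [WeightLE] at hw
  omega

theorem sqrt_le_frobeniusF (a : Fin 3 → ℕ) (ha : ∀ i, 0 < a i) (hgcd : Finset.univ.gcd a = 1) :
    Real.sqrt (3 * (a 0 : ℝ) * (a 1 : ℝ) * (a 2 : ℝ)) ≤ (frobeniusF a : ℝ) := by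
  obtain ⟨p, q, i, j, hcard, h1, h2⟩ := exists_lShape (ha 0) (ha 1) (ha 2) fun n => by
    obtain ⟨x, y, z, -, -, h⟩ := exists_pos_repr (ha 2) hgcd n
    refine ⟨x, y, ?_⟩
    rw [← Int.natCast_modEq_iff, Int.modEq_iff_dvd]
    exact ⟨-z, by push_cast; linarith⟩
  have hf1 : (a 0 * (p + 1) + a 0 * i + a 1 * (q + 1) : ℝ) ≤ frobeniusF a := by
    have : (((a 0 * (p + i + 1) + a 1 * (q + 1) : ℕ) : ℤ) : ℝ) ≤ frobeniusF a :=
      Int.cast_le.2 (le_frobeniusF_of_isLeastInClass (ha 2) hgcd h1)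
    push_cast at this
    linarith
  have hf2 : (a 0 * (p + 1) + a 1 * (q + 1) + a 1 * j : ℝ) ≤ frobeniusF a := by
    have : (((a 0 * (p + 1) + a 1 * (q + j + 1) : ℕ) : ℤ) : ℝ) ≤ frobeniusF a :=
      Int.cast_le.2 (le_frobeniusF_of_isLeastInClass (ha 2) hgcd h2)
    push_cast at this
    linarith
  have hc : (a 2 : ℝ) ≤ (p + 1) * (q + 1) + (p + 1) * j + i * (q + 1) := by exact_mod_cast hcard
  have hprod : (a 0 * a 1 * a 2 : ℝ) ≤ (a 0 * (p + 1)) * (a 1 * (q + 1)) +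
      (a 0 * (p + 1)) * (a 1 * j) + (a 0 * i) * (a 1 * (q + 1)) := by
    have := mul_le_mul_of_nonneg_left hc (by positivity : (0 : ℝ) ≤ a 0 * a 1)
    linarith
  have hA : (0 : ℝ) ≤ a 0 * (p + 1) := by positivity
  have hB : (0 : ℝ) ≤ a 1 * (q + 1) := by positivity
  have hI : (0 : ℝ) ≤ a 0 * i := by positivity
  have hJ : (0 : ℝ) ≤ a 1 * j := by positivity
  generalize (a 0 * (p + 1) : ℝ) = A at *
  generalize (a 1 * (q + 1) : ℝ) = B at *
  generalize (a 0 * i : ℝ) = I at *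
  generalize (a 1 * j : ℝ) = J at *
  have hF : (0 : ℝ) ≤ frobeniusF a := by linarith
  rw [Real.sqrt_le_iff]
  refine ⟨hF, ?_⟩
  -- `(A + B + K)² ≥ 3 (A B + A K + B K)`, with `K` the larger one of `I` and `J`.
  rcases le_total I J with hIJ | hIJ
  · have := pow_le_pow_left₀ (by positivity) hf2 2
    nlinarith [sq_nonneg (A - B), sq_nonneg (A - J), sq_nonneg (B - J),
      mul_nonneg hB (sub_nonneg.2 hIJ)]
  · have := pow_le_pow_left₀ (by positivity) hf1 2
    nlinarith [sq_nonneg (A - B), sq_nonneg (A - I), sq_nonneg (B - I),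
      mul_nonneg hA (sub_nonneg.2 hIJ)]

/-! ### An upper bound from two lattice vectors -/

/-- From the first two coefficients of a representation outside an L-shaped region, one of
`(w + r, -y)`, `(-w, y + s)` and their sum `(r, s)` can be subtracted such that the coefficients stay
positive; this makes the third coefficient larger. Hence every integer has a representation whose
first two coefficients lie in that region, and the third one is positive if the integer exceeds the
weights of the outer corners of the region. -/
theorem frobeniusF_le_max {a : Fin 3 → ℕ} (hc : 0 < a 2) (hgcd : Finset.univ.gcd a = 1)
    {w y r s k₁ k₂ : ℕ} (hk₁ : 0 < k₁) (hk₂ : 0 < k₂)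
    (h₁ : a 0 * (w + r) = a 1 * y + a 2 * k₁) (h₂ : a 1 * (y + s) = a 0 * w + a 2 * k₂) :
    frobeniusF a ≤ max ((a 0 * (w + r) + a 1 * s : ℕ) : ℤ) ((a 0 * r + a 1 * (y + s) : ℕ) : ℤ) := by
  by_contra! hlt
  apply (isGreatest_frobeniusF a hgcd).1
  have key : ∀ m : ℕ, ∀ (u v : ℕ) (z : ℤ), a 0 * u + a 1 * v = m → 0 < u → 0 < v →
      frobeniusF a = u * a 0 + v * a 1 + z * a 2 → IsPosCombination a (frobeniusF a) := by
    intro m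
    induction m using Nat.strong_induction_on with
    | _ m ih =>
      intro u v z hm hu hv hn
      have hp₁ := Nat.mul_pos hc hk₁
      have hp₂ := Nat.mul_pos hc hk₂
      by_cases hul : w + r < u
      · obtain ⟨i, rfl⟩ := Nat.exists_eq_add_of_lt hul
        refine ih _ ?_ (i + 1) (v + y) (z + k₁) rfl (by omega) (by omega) ?_
        · rw [← hm]; linarith
        · rw [hn]; zify at h₁; push_cast; linarith
      by_cases hvl : y + s < v
      · obtain ⟨i, rfl⟩ := Nat.exists_eq_add_of_lt hvl
        refine ih _ ?_ (u + w) (i + 1) (z + k₂) rfl (by omega) (by omega) ?_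
        · rw [← hm]; linarith
        · rw [hn]; zify at h₂; push_cast; linarith
      by_cases hcor : r < u ∧ s < v
      · obtain ⟨i, rfl⟩ := Nat.exists_eq_add_of_lt hcor.1
        obtain ⟨j, rfl⟩ := Nat.exists_eq_add_of_lt hcor.2
        refine ih _ ?_ (i + 1) (j + 1) (z + k₁ + k₂) rfl (by omega) (by omega) ?_
        · rw [← hm]; linarith
        · rw [hn]; zify at h₁ h₂; push_cast; linarith
      have hbound : ((a 0 * u + a 1 * v : ℕ) : ℤ) < frobeniusF a := by
        refine lt_of_le_of_lt (le_max_iff.2 ?_) hlt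
        by_cases hr : r < u
        · left
          exact_mod_cast Nat.add_le_add (Nat.mul_le_mul_left _ (by omega))
            (Nat.mul_le_mul_left _ (by omega))
        · right
          exact_mod_cast Nat.add_le_add (Nat.mul_le_mul_left _ (by omega))
            (Nat.mul_le_mul_left _ (by omega))
      have hz : 0 < z := by
        push_cast at hbound
        have : 0 < z * (a 2 : ℤ) := by linarith
        exact pos_of_mul_pos_left this (by positivity)
      lift z to ℕ using hz.le
      refine ⟨![u, v, z], ?_, ?_⟩
      · intro i
        fin_cases i
        · exact hu
        · exact hv
        · exact_mod_cast hz
      · rw [Fin.sum_univ_three]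
        exact hn
  obtain ⟨x, y, z, hx, hy, hn⟩ := exists_pos_repr hc hgcd (frobeniusF a)
  exact key _ x y z rfl hx hy hn

/-! ### A family attaining the bound asymptotically -/

/-- The generators are the minors of the lattice vectors `T (2P, -Q, -R) + (1, 0, 0)` and
`T (-P, 2Q, -R) + (0, 1, 0)`. For `T → ∞` their ratio tends to `1 / P : 1 / Q : 1 / R`. -/
def extremalTriple (P Q R T : ℕ) : Fin 3 → ℕ :=
  ![R * T * (3 * Q * T + 1), R * T * (3 * P * T + 1), 3 * P * Q * T ^ 2 + 2 * (P + Q) * T + 1]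

/-- A common prime divisor does not divide `T`, since the last generator is `1` modulo `T`. So it
divides `3 Q T + 1` and `3 P T + 1`, hence their difference `3 T (P - Q)`. -/
theorem gcd_extremalTriple {P Q R T : ℕ} (hT : R ∣ T) (hT' : (P : ℤ) - Q ∣ T) :
    Finset.univ.gcd (extremalTriple P Q R T) = 1 := by
  by_contra hne
  obtain ⟨p, hp, hdvd⟩ := Nat.exists_prime_and_dvd hne
  have hd : ∀ i, p ∣ extremalTriple P Q R T i := fun i =>
    hdvd.trans (Finset.gcd_dvd (Finset.mem_univ i))
  have h0 : p ∣ R * T * (3 * Q * T + 1) := hd 0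
  have h1 : p ∣ R * T * (3 * P * T + 1) := hd 1
  have h2 : p ∣ 3 * P * Q * T ^ 2 + 2 * (P + Q) * T + 1 := hd 2
  have hpT : ¬ p ∣ T := fun h => hp.not_dvd_one
    ((Nat.dvd_add_right (dvd_add ((dvd_pow h two_ne_zero).mul_left _) (h.mul_left _))).1 h2)
  have hpRT : ¬ p ∣ R * T := fun h => (hp.dvd_mul.1 h).elim (fun h => hpT (h.trans hT)) hpT
  have h0' := (hp.dvd_mul.1 h0).resolve_left hpRT
  have h1' := (hp.dvd_mul.1 h1).resolve_left hpRT
  have hp' := Nat.prime_iff_prime_int.1 hp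
  have hsub : (p : ℤ) ∣ 3 * (T * (P - Q)) := by
    have := dvd_sub (Int.natCast_dvd_natCast.2 h1') (Int.natCast_dvd_natCast.2 h0')
    push_cast at this
    rwa [show 3 * (T * (P - Q) : ℤ) = 3 * P * T + 1 - (3 * Q * T + 1) by ring]
  rcases hp'.dvd_or_dvd hsub with h3 | h3
  · have h3 : p ∣ 3 := by exact_mod_cast h3
    exact hp.not_dvd_one
      ((Nat.dvd_add_right ((h3.mul_right Q).mul_right T)).1 h0')
  · rcases hp'.dvd_or_dvd h3 with h4 | h4
    · exact hpT (Int.natCast_dvd_natCast.1 h4)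
    · exact hpT (Int.natCast_dvd_natCast.1 (h4.trans hT'))

theorem frobeniusF_extremalTriple_le {P Q R T : ℕ} (hR : 0 < R) (hT0 : 0 < T) (hT : R ∣ T)
    (hT' : (P : ℤ) - Q ∣ T) :
    (frobeniusF (extremalTriple P Q R T) : ℝ) ≤
      max ((R : ℝ) * T * (3 * Q * T + 1) * (2 * P * T + 1) +
          R * T * (3 * P * T + 1) * (Q * T + 1))
        (R * T * (3 * Q * T + 1) * (P * T + 1) + R * T * (3 * P * T + 1) * (2 * Q * T + 1)) := by
  have hRT := Nat.mul_pos hR hT0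
  have h := frobeniusF_le_max (a := extremalTriple P Q R T) (w := P * T) (y := Q * T)
    (r := P * T + 1) (s := Q * T + 1) (Nat.succ_pos _) (gcd_extremalTriple hT hT') hRT hRT
    (by simp only [extremalTriple, Matrix.cons_val]; ring)
    (by simp only [extremalTriple, Matrix.cons_val]; ring)
  have h' : (frobeniusF (extremalTriple P Q R T) : ℝ) ≤ _ := Int.cast_le.2 h
  refine h'.trans (le_of_eq ?_)
  simp only [extremalTriple, Matrix.cons_val]
  push_cast
  congr 1 <;> ring_nf

open Filter Topology in
/-- In terms of `u = 1 / T`, every quantity involved is a power of `T` times a polynomial in `u`,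
and the limit `u → 0` of the inequality for `frobeniusF` is `81 (PQR)² < 27 (3 + ε) (PQR)²`. -/
theorem eventually_extremalTriple {P Q R : ℕ} (hP : 0 < P) (hQ : 0 < Q) (hR : 0 < R) {ε : ℝ}
    (hε : 0 < ε) {α β : ℝ} (hα : |α - R / P| < ε) (hβ : |β - R / Q| < ε) :
    ∀ᶠ T : ℕ in atTop,
      |α - (extremalTriple P Q R T 0 : ℝ) / (extremalTriple P Q R T 2 : ℝ)| < ε ∧
      |β - (extremalTriple P Q R T 1 : ℝ) / (extremalTriple P Q R T 2 : ℝ)| < ε ∧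
      max ((R : ℝ) * T * (3 * Q * T + 1) * (2 * P * T + 1) +
          R * T * (3 * P * T + 1) * (Q * T + 1))
        (R * T * (3 * Q * T + 1) * (P * T + 1) + R * T * (3 * P * T + 1) * (2 * Q * T + 1)) <
      Real.sqrt ((3 + ε) * (extremalTriple P Q R T 0 : ℝ) * (extremalTriple P Q R T 1 : ℝ) *
        (extremalTriple P Q R T 2 : ℝ)) := by
  have hP' : (0 : ℝ) < P := by exact_mod_cast hP
  have hQ' : (0 : ℝ) < Q := by exact_mod_cast hQ
  have hR' : (0 : ℝ) < R := by exact_mod_cast hR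
  let c : ℝ → ℝ := fun u => 3 * P * Q + 2 * (P + Q) * u + u ^ 2
  have hc0 : c 0 ≠ 0 := by simp only [c]; positivity
  have e1 : ∀ᶠ u in 𝓝 (0 : ℝ), |α - R * (3 * Q + u) / c u| < ε := by
    have hcont : ContinuousAt (fun u : ℝ => |α - R * (3 * Q + u) / c u|) 0 := by
      fun_prop (disch := exact hc0)
    refine hcont.eventually_lt_const ?_
    have hval : (R * (3 * Q + 0) / c 0 : ℝ) = R / P := by
      simp only [c]
      field_simp
      ring
    simpa only [hval] using hα
  have e2 : ∀ᶠ u in 𝓝 (0 : ℝ), |β - R * (3 * P + u) / c u| < ε := by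
    have hcont : ContinuousAt (fun u : ℝ => |β - R * (3 * P + u) / c u|) 0 := by
      fun_prop (disch := exact hc0)
    refine hcont.eventually_lt_const ?_
    have hval : (R * (3 * P + 0) / c 0 : ℝ) = R / Q := by
      simp only [c]
      field_simp
      ring
    simpa only [hval] using hβ
  have hlim : 81 * ((P : ℝ) * Q * R) ^ 2 < (3 + ε) * 27 * (P * Q * R) ^ 2 := by
    have : 0 < ε * ((P : ℝ) * Q * R) ^ 2 := by positivity
    linarith
  have e3 : ∀ᶠ u in 𝓝 (0 : ℝ),
      (R * (3 * Q + u) * (2 * P + u) + R * (3 * P + u) * (Q + u)) ^ 2 <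
        (3 + ε) * (R * (3 * Q + u)) * (R * (3 * P + u)) * c u := by
    refine ContinuousAt.eventually_lt (by fun_prop) (by fun_prop) ?_
    simp only [c]
    linarith
  have e4 : ∀ᶠ u in 𝓝 (0 : ℝ),
      (R * (3 * Q + u) * (P + u) + R * (3 * P + u) * (2 * Q + u)) ^ 2 <
        (3 + ε) * (R * (3 * Q + u)) * (R * (3 * P + u)) * c u := by
    refine ContinuousAt.eventually_lt (by fun_prop) (by fun_prop) ?_
    simp only [c]
    linarith
  have hinv := tendsto_inv_atTop_nhds_zero_nat (𝕜 := ℝ)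
  filter_upwards [hinv.eventually e1, hinv.eventually e2, hinv.eventually e3, hinv.eventually e4,
    eventually_gt_atTop 0] with T h1 h2 h3 h4 hT
  have hT' : (0 : ℝ) < T := by exact_mod_cast hT
  have ha : (extremalTriple P Q R T 0 : ℝ) = T ^ 2 * (R * (3 * Q + (T : ℝ)⁻¹)) := by
    simp only [extremalTriple, Matrix.cons_val]
    push_cast
    field_simp
  have hb : (extremalTriple P Q R T 1 : ℝ) = T ^ 2 * (R * (3 * P + (T : ℝ)⁻¹)) := by
    simp only [extremalTriple, Matrix.cons_val]
    push_cast
    field_simp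
  have hcT : (extremalTriple P Q R T 2 : ℝ) = T ^ 2 * c (T : ℝ)⁻¹ := by
    simp only [extremalTriple, Matrix.cons_val, c]
    push_cast
    field_simp
  have hT2 : (T : ℝ) ^ 2 ≠ 0 := by positivity
  have hT6 : (0 : ℝ) < T ^ 6 := by positivity
  rw [ha, hb, hcT, mul_div_mul_left _ _ hT2, mul_div_mul_left _ _ hT2]
  refine ⟨h1, h2, max_lt ?_ ?_⟩
  · apply Real.lt_sqrt_of_sq_lt
    refine Eq.trans_lt ?_ ((mul_lt_mul_of_pos_left h3 hT6).trans_eq ?_)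
    · field_simp
    · ring
  · apply Real.lt_sqrt_of_sq_lt
    refine Eq.trans_lt ?_ ((mul_lt_mul_of_pos_left h4 hT6).trans_eq ?_)
    · field_simp
    · ring

/-! ### Approximation of the ratios -/

theorem exists_rat_approx {ε α β : ℝ} (hε : 0 < ε) (hα : 0 ≤ α) (hαβ : α ≤ β) (hβ : β ≤ 1) :
    ∃ q r : ℚ, 0 < q ∧ q < r ∧ r < 1 ∧ |α - q| < ε ∧ |β - r| < ε := by
  obtain ⟨q, hq1, hq2⟩ := exists_rat_btwn (show max 0 (α - ε) < min (1 : ℝ) (α + ε) by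
    simp only [max_lt_iff, lt_min_iff]; constructor <;> constructor <;> linarith)
  simp only [max_lt_iff, lt_min_iff] at hq1 hq2
  obtain ⟨r, hr1, hr2⟩ := exists_rat_btwn (show max (q : ℝ) (β - ε) < min (1 : ℝ) (β + ε) by
    simp only [max_lt_iff, lt_min_iff]; constructor <;> constructor <;> linarith)
  simp only [max_lt_iff, lt_min_iff] at hr1 hr2
  refine ⟨q, r, by exact_mod_cast hq1.1, by exact_mod_cast hr1.1, by exact_mod_cast hr2.1, ?_, ?_⟩
    <;> rw [abs_lt] <;> constructor <;> linarith

theorem exists_ratio_approx {ε α β : ℝ} (hε : 0 < ε) (hα : 0 ≤ α) (hαβ : α ≤ β) (hβ : β ≤ 1) :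
    ∃ P Q R : ℕ, 0 < R ∧ R < Q ∧ Q < P ∧ |α - R / P| < ε ∧ |β - R / Q| < ε := by
  obtain ⟨q, r, hq, hqr, hr, hαq, hβr⟩ := exists_rat_approx hε hα hαβ hβ
  have hr0 := hq.trans hqr
  obtain ⟨m, hm⟩ := Int.eq_ofNat_of_zero_le (Rat.num_pos.2 hq).le
  obtain ⟨n, hn⟩ := Int.eq_ofNat_of_zero_le (Rat.num_pos.2 hr0).le
  have hm0 : 0 < m := by have := Rat.num_pos.2 hq; omega
  have hn0 : 0 < n := by have := Rat.num_pos.2 hr0; omega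
  have hqd := q.den_pos
  have hrd := r.den_pos
  have hqe : q = m / q.den := by
    conv_lhs => rw [← Rat.num_div_den q, hm]
    simp
  have hre : r = n / r.den := by
    conv_lhs => rw [← Rat.num_div_den r, hn]
    simp
  generalize q.den = d at *
  generalize r.den = e at *
  subst hqe hre
  have hd' : (0 : ℚ) < d := by exact_mod_cast hqd
  have he' : (0 : ℚ) < e := by exact_mod_cast hrd
  have hm' : (m : ℝ) ≠ 0 := by positivity
  have hn' : (n : ℝ) ≠ 0 := by positivity
  rw [div_lt_div_iff₀ hd' he'] at hqr
  rw [div_lt_one he'] at hr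
  have hqr : m * e < n * d := by exact_mod_cast hqr
  have hr : n < e := by exact_mod_cast hr
  refine ⟨d * n, m * e, m * n, by positivity, by gcongr, by linarith, ?_, ?_⟩
  · push_cast at hαq ⊢
    rwa [mul_div_mul_right _ _ hn']
  · push_cast at hβr ⊢
    rwa [mul_div_mul_left _ _ hm']

theorem corollary2 :
    (∀ a : Fin 3 → ℕ, (∀ i, 0 < a i) → Finset.univ.gcd a = 1 →
      Real.sqrt (3 * (a 0 : ℝ) * (a 1 : ℝ) * (a 2 : ℝ)) ≤ (frobeniusF a : ℝ)) ∧
    (∀ ε : ℝ, 0 < ε → ∀ α : Fin 2 → ℝ, 0 ≤ α 0 → α 0 ≤ α 1 → α 1 ≤ 1 →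
      ∃ a : Fin 3 → ℕ, 0 < a 0 ∧ a 0 < a 1 ∧ a 1 < a 2 ∧ Finset.univ.gcd a = 1 ∧
        (∀ i : Fin 2, |α i - (a i.castSucc : ℝ) / (a 2 : ℝ)| < ε) ∧
        (frobeniusF a : ℝ) < Real.sqrt ((3 + ε) * (a 0 : ℝ) * (a 1 : ℝ) * (a 2 : ℝ))) := by
  refine ⟨sqrt_le_frobeniusF, fun ε hε α h0 h01 h1 => ?_⟩
  obtain ⟨P, Q, R, hR, hRQ, hQP, hα, hβ⟩ := exists_ratio_approx hε h0 h01 h1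
  obtain ⟨N, hN⟩ := Filter.eventually_atTop.1
    (eventually_extremalTriple (by omega) (by omega) hR hε hα hβ)
  -- With `T` a multiple of `R (P - Q)` the generators are coprime.
  obtain ⟨D, rfl⟩ := Nat.exists_eq_add_of_lt hQP
  have hRD : 0 < R * (D + 1) := by positivity
  have hT : R ∣ R * (D + 1) * (N + 1) := (dvd_mul_right _ _).mul_right _
  have hT' : ((Q + D + 1 : ℕ) : ℤ) - Q ∣ (R * (D + 1) * (N + 1) : ℕ) :=
    ⟨R * (N + 1), by push_cast; ring⟩
  have hNT : N ≤ R * (D + 1) * (N + 1) := by nlinarith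
  have hT0 : 0 < R * (D + 1) * (N + 1) := by positivity
  generalize R * (D + 1) * (N + 1) = T at *
  obtain ⟨hαT, hβT, hlt⟩ := hN T hNT
  refine ⟨extremalTriple (Q + D + 1) Q R T, ?_, ?_, ?_, gcd_extremalTriple hT hT', ?_,
    (frobeniusF_extremalTriple_le hR hT0 hT hT').trans_lt hlt⟩
  · simp only [extremalTriple, Matrix.cons_val]
    positivity
  · simp only [extremalTriple, Matrix.cons_val]
    gcongr
  · simp only [extremalTriple, Matrix.cons_val]
    nlinarith [Nat.mul_le_mul_right ((Q + D + 1) * T ^ 2) hRQ.le, Nat.mul_le_mul_right T hRQ.le]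
  · intro i
    fin_cases i
    · exact hαT
    · exact hβT
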